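/- Let $t\ge 1$ be an integer. A $t$-edge-colored graph is a finite simple graph each of whose edges has one of $t$ colors (the coloring need not be proper). A copy of a graph $F$ in it is rainbow if its edges have pairwise different colors. A $t$-edge-colored graph is rainbow $F$-saturated if it contains no rainbow copy of $F$, but adding any missing edge in any of the $t$ colors creates a rainbow copy of $F$. Let $\mathrm{rsat}_t(n,F)$ denote the minimum number of edges of a $t$-edge-colored rainbow $F$-saturated graph on $n$ vertices. Theorem. Let $s\ge 3$ and $t\ge\binom{s}{2}$ be fixed integers. Then, as $n\to\infty$, $$\mathrm{rsat}_t(n,K_s)\ \ge\ \frac{t\,(1+o(1))}{(t-s+2)\log(t-s+2)}\,n\log n .$$ For $s=3$ this holds with equality, i.e. $$\mathrm{rsat}_t(n,K_3)=\frac{t\,(1+o(1))}{(t-1)\log(t-1)}\,n\log n .$$ Moreover, for all fixed $s\ge 3$ and $t\ge\binom{s}{2}$, $\mathrm{rsat}_t(n,K_s)=\Theta(n\log n)$ as $n\to\infty$ (the conjecture of Barrus, Ferrara, Vandenbussche and Wenger). -/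

import Mathlib

open Filter Topology Asymptotics

/-- The graph `G`, whose edges are coloured by `c` (only the values of `c` on edges of `G` matter),
contains a rainbow copy of `F`: a not necessarily induced copy of `F` in `G` whose edges have
pairwise different colours. -/
def HasRainbowCopy {V W K : Type*} (F : SimpleGraph W) (G : SimpleGraph V) (c : Sym2 V → K) :
    Prop :=
  ∃ f : SimpleGraph.Copy F G, Set.InjOn (fun e : Sym2 W => c (e.map f)) F.edgeSet

open Classical in
/-- The edge-coloured graph `(G, c)` is rainbow `F`-saturated: it has no rainbow copy of `F`, but
adding any missing edge `uv` to `G`, in any colour `a`, creates a rainbow copy of `F`. -/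
def IsRainbowSaturated {V W K : Type*} (F : SimpleGraph W) (G : SimpleGraph V) (c : Sym2 V → K) :
    Prop :=
  ¬ HasRainbowCopy F G c ∧
    ∀ u v : V, u ≠ v → ¬ G.Adj u v → ∀ a : K,
      HasRainbowCopy F (G ⊔ SimpleGraph.edge u v) (Function.update c s(u, v) a)

/-- The `t`-coloured rainbow saturation number `rsat_t(n, F)`: the minimum number of edges of a
rainbow `F`-saturated graph on `n` vertices whose edges are coloured with `t` colours. -/
noncomputable def rsat {W : Type*} (t n : ℕ) (F : SimpleGraph W) : ℕ :=
  sInf {m : ℕ | ∃ (G : SimpleGraph (Fin n)) (c : Sym2 (Fin n) → Fin t),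
    IsRainbowSaturated F G c ∧ G.edgeSet.ncard = m}

/-- The minimum in the definition of `rsat` is attained for complete graphs on at least three
vertices: a monochromatic complete graph is rainbow saturated. -/
theorem exists_rsat_eq {s t : ℕ} (n : ℕ) (hs : 3 ≤ s) (ht : 1 ≤ t) :
    ∃ (G : SimpleGraph (Fin n)) (c : Sym2 (Fin n) → Fin t),
      IsRainbowSaturated (⊤ : SimpleGraph (Fin s)) G c ∧
        G.edgeSet.ncard = rsat t n (⊤ : SimpleGraph (Fin s)) := by
  refine Nat.sInf_mem (s := {m : ℕ | ∃ (G : SimpleGraph (Fin n)) (c : Sym2 (Fin n) → Fin t),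
    IsRainbowSaturated (⊤ : SimpleGraph (Fin s)) G c ∧ G.edgeSet.ncard = m})
    ⟨_, ⊤, fun _ => ⟨0, ht⟩, ⟨?_, ?_⟩, rfl⟩
  · rintro ⟨f, hf⟩
    have h := hf (x₁ := s((⟨0, by omega⟩ : Fin s), ⟨1, by omega⟩))
      (x₂ := s((⟨0, by omega⟩ : Fin s), ⟨2, by omega⟩)) (by simp) (by simp) rfl
    simp at h
  · intro u v huv h
    exact absurd huv (by simpa using h)

/-! ### Rainbow cliques and what saturation forces on a missing edge -/

section Basics

variable {V W K : Type*}

/-! Lower bound. Fix a set `A` of `s - 2` colours. In a saturated graph any two non-adjacent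
vertices have a common neighbour joined to them in two different colours outside `A`
(`IsRainbowSaturated.exists_common_neighbor`). Call a vertex low if its degree is at most `D`.
Choose for every vertex `w` a random colour `φ w` outside `A`, and keep a low vertex `v` when `φ w`
is the colour of `vw` for every high neighbour `w` joined to `v` by a colour outside `A`. Two kept
vertices cannot be separated by a high vertex, so they are adjacent or have a low common neighbour,
and at most `1 + D + D²` are kept. Since `v` is kept with probability `(t-s+2)^(-d_A(v))`, convexity
bounds the sum of the `d_A(v)` from below, and averaging over `A` gives the factor `t/(t-s+2)`. With
`D` about `log² n` there are few high vertices and the cap is polylogarithmic.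

Upper bounds. Join an independent set completely to a small `(s-2)`-partite core. This graph has no
`K_s`. If the colour words of the outer vertices are such that every missing outer edge, in every
colour, closes a rainbow `K_s`, a greedy completion adds only edges meeting the core
(`rsat_le_mul_of_core`). Binary expansions give a core of size `O(log n)`, hence the order `n log
n`.

For triangles the core is edgeless and one needs a code in which, for each colour `a`, any two words
differ somewhere with neither letter equal to `a`. The optimal rate `((t-1)/t) log(t-1)` comes from
balanced words on a grid: two different words with the same `a`-positions differ only where neither
has an `a`, and pigeonholing on sums of position sets forces such agreement for all `a` at once
(`exists_grid_family`), at a cost per block of essentially one position set rather than `t`. -/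

theorem hasRainbowCopy_top_iff {G : SimpleGraph V} {c : Sym2 V → K} :
    HasRainbowCopy (⊤ : SimpleGraph W) G c ↔
      ∃ f : W → V, Function.Injective f ∧ (∀ x y, x ≠ y → G.Adj (f x) (f y)) ∧
        Set.InjOn (fun e : Sym2 W => c (e.map f)) (⊤ : SimpleGraph W).edgeSet := by
  constructor
  · rintro ⟨f, hf⟩
    exact ⟨f, f.injective, fun x y hxy => f.toHom.map_adj (by simpa using hxy), hf⟩
  · rintro ⟨f, hinj, hadj, hf⟩
    exact ⟨⟨⟨f, fun {x y} h => hadj x y (by simpa using h)⟩, hinj⟩, hf⟩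

theorem HasRainbowCopy.mono {F : SimpleGraph W} {V' : Type*} {G : SimpleGraph V}
    {G' : SimpleGraph V'} {c : Sym2 V → K} {c' : Sym2 V' → K} (f : V → V')
    (hf : Function.Injective f) (hadj : ∀ u v, G.Adj u v → G'.Adj (f u) (f v))
    (hc : ∀ u v, G.Adj u v → c' s(f u, f v) = c s(u, v)) (h : HasRainbowCopy F G c) :
    HasRainbowCopy F G' c' := by
  obtain ⟨g, hg⟩ := h
  refine ⟨(⟨⟨f, fun {x y} h => hadj x y h⟩, hf⟩ : SimpleGraph.Copy G G').comp g, ?_⟩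
  have key : ∀ e ∈ F.edgeSet, c' (e.map (f ∘ g)) = c (e.map g) := by
    intro e
    induction e with
    | _ x y =>
      intro he
      exact hc _ _ (g.toHom.map_adj he)
  intro e he e' he' hee
  refine hg he he' ?_
  have h1 := key e he
  have h2 := key e' he'
  change c' (e.map (f ∘ g)) = c' (e'.map (f ∘ g)) at hee
  simp only
  rw [← h1, ← h2, hee]

open Classical in
/-- If adding a missing edge in the colour `a` creates a rainbow clique, then the ends of the
missing edge have a common neighbour, to which they are joined in different colours that both
avoid a given set of `s - 2` colours containing `a`. -/
theorem IsRainbowSaturated.exists_common_neighbor {s : ℕ} {G : SimpleGraph V} {c : Sym2 V → K}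
    (hG : IsRainbowSaturated (⊤ : SimpleGraph (Fin s)) G c) {u v : V} (huv : u ≠ v)
    (hadj : ¬ G.Adj u v) {A : Finset K} (hA : A.card = s - 2) (hs : 3 ≤ s) :
    ∃ w, G.Adj u w ∧ G.Adj v w ∧ c s(u, w) ≠ c s(v, w) ∧ c s(u, w) ∉ A ∧ c s(v, w) ∉ A := by
  obtain ⟨a, ha⟩ : A.Nonempty := Finset.card_pos.1 (by omega)
  obtain ⟨f, hinj, hf, hrb⟩ := hasRainbowCopy_top_iff.1 (hG.2 u v huv hadj a)
  have hxy : ∃ x y, f x = u ∧ f y = v := by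
    by_contra hno
    push Not at hno
    refine hG.1 (hasRainbowCopy_top_iff.2 ⟨f, hinj, ?_, ?_⟩)
    · intro x y hxy
      have := hf x y hxy
      rw [SimpleGraph.sup_adj, SimpleGraph.edge_adj] at this
      rcases this with h | h
      · exact h
      · rcases h.1 with h | h
        · exact (hno x y h.1 h.2).elim
        · exact (hno y x h.2 h.1).elim
    · have key : ∀ e : Sym2 (Fin s), Function.update c s(u, v) a (e.map f) = c (e.map f) := by
        intro e
        induction e with
        | _ x y =>
          apply Function.update_of_ne
          intro h
          rw [Sym2.map_mk, Sym2.eq_iff] at h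
          rcases h with h | h
          · exact hno x y h.1 h.2
          · exact hno y x h.2 h.1
      intro e he e' he' hee
      exact hrb he he' (by simpa only [key] using hee)
  obtain ⟨x, y, rfl, rfl⟩ := hxy
  have hxy : x ≠ y := fun h => huv (by rw [h])
  have hG' : ∀ p q, p ≠ q → s(p, q) ≠ s(x, y) → G.Adj (f p) (f q) := by
    intro p q hpq hne
    have := hf p q hpq
    rw [SimpleGraph.sup_adj, SimpleGraph.edge_adj] at this
    rcases this with h | h
    · exact h
    · exfalso
      apply hne
      rw [Sym2.eq_iff]
      rcases h.1 with h | h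
      · exact Or.inl ⟨hinj h.1, hinj h.2⟩
      · exact Or.inr ⟨hinj h.1, hinj h.2⟩
  have hcol : ∀ p q, s(p, q) ≠ s(x, y) →
      Function.update c s(f x, f y) a s(f p, f q) = c s(f p, f q) := by
    intro p q hne
    apply Function.update_of_ne
    intro h
    apply hne
    rw [Sym2.eq_iff] at h ⊢
    exact h.imp (fun h => ⟨hinj h.1, hinj h.2⟩) (fun h => ⟨hinj h.1, hinj h.2⟩)
  have hrb' : ∀ p q p' q', p ≠ q → p' ≠ q' → s(p, q) ≠ s(x, y) → s(p', q') ≠ s(x, y) →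
      c s(f p, f q) = c s(f p', f q') → s(p, q) = s(p', q') := by
    intro p q p' q' h1 h2 h3 h4 h5
    refine hrb (by simpa using h1) (by simpa using h2) ?_
    simp only [Sym2.map_mk]
    rw [hcol _ _ h3, hcol _ _ h4, h5]
  have hna : ∀ p q, p ≠ q → s(p, q) ≠ s(x, y) → c s(f p, f q) ≠ a := by
    intro p q h1 h2 h3
    refine h2 (hrb (by simpa using h1) (by simpa using hxy) ?_)
    simp only [Sym2.map_mk]
    rw [hcol _ _ h2, Function.update_self, h3]
  have hz1 : ∀ z, z ≠ x → z ≠ y → s(x, z) ≠ s(x, y) := by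
    intro z h1 h2 h
    rw [Sym2.eq_iff] at h
    grind
  have hz2 : ∀ z, z ≠ x → z ≠ y → s(y, z) ≠ s(x, y) := by
    intro z h1 h2 h
    rw [Sym2.eq_iff] at h
    grind
  by_contra hcon
  push Not at hcon
  let Z : Finset (Fin s) := (Finset.univ.erase x).erase y
  have hZ : Z.card = s - 2 := by
    rw [Finset.card_erase_of_mem (by simp [hxy.symm]), Finset.card_erase_of_mem (by simp)]
    simp
    omega
  -- If no `w` works, each of the `s - 2` remaining clique vertices is joined to an end of the new
  -- edge by a colour of `A`. That colour is not `a`, which the new edge uses, so only `s - 3`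
  -- values are available and two edges of the rainbow clique share a colour.
  let g : Fin s → K := fun z => if c s(f x, f z) ∈ A then c s(f x, f z) else c s(f y, f z)
  have hmaps : ∀ z ∈ Z, g z ∈ A.erase a := by
    intro z hz
    have hz' : z ≠ y ∧ z ≠ x := by simpa [Z] using hz
    have e1 := hz1 z hz'.2 hz'.1
    have e2 := hz2 z hz'.2 hz'.1
    simp only [g]
    split_ifs with h
    · exact Finset.mem_erase.2 ⟨hna _ _ hz'.2.symm e1, h⟩
    · refine Finset.mem_erase.2 ⟨hna _ _ hz'.1.symm e2, ?_⟩
      refine hcon _ (hG' _ _ hz'.2.symm e1) (hG' _ _ hz'.1.symm e2) ?_ h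
      intro h5
      have := hrb' _ _ _ _ hz'.2.symm hz'.1.symm e1 e2 h5
      rw [Sym2.eq_iff] at this
      grind
  obtain ⟨z, hz, z', hz', hne, heq⟩ := Finset.exists_ne_map_eq_of_card_lt_of_maps_to
    (by rw [hZ, Finset.card_erase_of_mem ha, hA]; omega) hmaps
  have h1 : z ≠ y ∧ z ≠ x := by simpa [Z] using hz
  have h2 : z' ≠ y ∧ z' ≠ x := by simpa [Z] using hz'
  have e1 := hz1 z h1.2 h1.1
  have e2 := hz2 z h1.2 h1.1
  have e3 := hz1 z' h2.2 h2.1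
  have e4 := hz2 z' h2.2 h2.1
  simp only [g] at heq
  split_ifs at heq
  · have := hrb' _ _ _ _ h1.2.symm h2.2.symm e1 e3 heq
    rw [Sym2.eq_iff] at this; grind
  · have := hrb' _ _ _ _ h1.2.symm h2.1.symm e1 e4 heq
    rw [Sym2.eq_iff] at this; grind
  · have := hrb' _ _ _ _ h1.1.symm h2.2.symm e2 e3 heq
    rw [Sym2.eq_iff] at this; grind
  · have := hrb' _ _ _ _ h1.1.symm h2.1.symm e2 e4 heq
    rw [Sym2.eq_iff] at this; grind

end Basics

/-! ### Random colour choices: the finite lower bound -/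

section Lower

/-- Tangent line form of Jensen's inequality for `d ↦ q ^ (-d)`. -/
theorem card_mul_log_le_of_sum_inv_pow_le {ι : Type*} (S : Finset ι) (d : ι → ℕ) {q M : ℝ}
    (hq : 1 ≤ q) (hM : 0 < M) (h : ∑ v ∈ S, (q⁻¹) ^ d v ≤ M) :
    (S.card : ℝ) * Real.log (S.card / M) ≤ Real.log q * ∑ v ∈ S, (d v : ℝ) := by
  rcases S.eq_empty_or_nonempty with rfl | hS
  · simp
  have hN : (0 : ℝ) < S.card := by exact_mod_cast hS.card_pos
  have hq0 : 0 < q := by linarith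
  set x := Real.log (S.card / M)
  have hx : Real.exp (-x) = M / S.card := by
    rw [Real.exp_neg, Real.exp_log (by positivity), inv_div]
  have h1 : ∀ v ∈ S, M / S.card * (1 + x - Real.log q * d v) ≤ (q⁻¹) ^ d v := by
    intro v _
    have : (q⁻¹) ^ d v = Real.exp (-x) * Real.exp (x - Real.log q * d v) := by
      rw [← Real.exp_add, ← Real.exp_log (inv_pos.2 hq0), ← Real.exp_nat_mul, Real.log_inv]
      congr 1; ring
    rw [this, hx]
    gcongr
    linarith [Real.add_one_le_exp (x - Real.log q * d v)]
  have h2 := (Finset.sum_le_sum h1).trans h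
  rw [← Finset.mul_sum, Finset.sum_sub_distrib, Finset.sum_const, nsmul_eq_mul,
    ← Finset.mul_sum, div_mul_eq_mul_div, div_le_iff₀ hN] at h2
  have := le_of_mul_le_mul_left h2 hM
  linarith

open Classical in
/-- Double counting the colour choices `φ : V → B` and the vertices compatible with them. -/
theorem sum_inv_pow_le {V K : Type*} [Fintype V] (G : SimpleGraph V) (c : Sym2 V → K)
    (H S : Finset V) (B : Finset K) (hB : B.Nonempty) (M : ℕ)
    (hM : ∀ T ⊆ S, (∀ u ∈ T, ∀ v ∈ T, ∀ w ∈ H, G.Adj u w → G.Adj v w →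
      c s(u, w) ∈ B → c s(v, w) ∈ B → c s(u, w) = c s(v, w)) → T.card ≤ M) :
    ∑ v ∈ S, ((B.card : ℝ)⁻¹) ^ (H.filter fun w => G.Adj v w ∧ c s(v, w) ∈ B).card ≤ M := by
  have hq : (0 : ℝ) < B.card := by exact_mod_cast hB.card_pos
  let Φ : Finset (V → K) := Fintype.piFinset fun _ => B
  -- `R v φ` below is the survival of `v`. It fixes `φ` exactly on the `w` with `P v w`, so a
  -- fraction `|B|^(-d)` of all `φ` is compatible with `v`, where `d` counts those `w`.
  let P : V → V → Prop := fun v w => w ∈ H ∧ G.Adj v w ∧ c s(v, w) ∈ B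
  let R : V → (V → K) → Prop := fun v φ => ∀ w, P v w → φ w = c s(v, w)
  have hΦ : Φ.card = B.card ^ Fintype.card V := by
    simp [Φ]
  have h1 : ∀ φ ∈ Φ, (S.filter fun v => R v φ).card ≤ M := by
    intro φ _
    refine hM _ (Finset.filter_subset _ _) ?_
    intro u hu v hv w hw huw hvw hu' hv'
    rw [Finset.mem_filter] at hu hv
    rw [← hu.2 w ⟨hw, huw, hu'⟩, ← hv.2 w ⟨hw, hvw, hv'⟩]
  have h2 : ∀ v, ((Φ.filter fun φ => R v φ).card : ℝ) = (B.card : ℝ) ^ Fintype.card V *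
      ((B.card : ℝ)⁻¹) ^ (H.filter fun w => G.Adj v w ∧ c s(v, w) ∈ B).card := by
    intro v
    have : (Φ.filter fun φ => R v φ) =
        Fintype.piFinset fun w => if P v w then {c s(v, w)} else B := by
      ext φ
      simp only [Φ, R, Finset.mem_filter, Fintype.mem_piFinset]
      constructor
      · rintro ⟨h3, h4⟩ w
        split_ifs with h
        · simpa using h4 w h
        · exact h3 w
      · intro h3
        refine ⟨fun w => ?_, fun w hw => ?_⟩
        · have := h3 w
          split_ifs at this with h
          · rw [Finset.mem_singleton] at this
            rw [this]; exact h.2.2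
          · exact this
        · have := h3 w
          rw [if_pos hw] at this
          simpa using this
    rw [this, Fintype.card_piFinset, Nat.cast_prod]
    have h5 : ∀ w, (((if P v w then {c s(v, w)} else B : Finset K).card : ℕ) : ℝ) =
        B.card * (if P v w then (B.card : ℝ)⁻¹ else 1) := by
      intro w
      split_ifs
      · simp [hq.ne']
      · simp
    simp_rw [h5]
    rw [Finset.prod_mul_distrib, Finset.prod_const, Finset.card_univ, Finset.prod_ite]
    simp only [Finset.prod_const, one_pow, mul_one]
    congr 3
    ext w
    simp [P]
  have h3 : ∑ φ ∈ Φ, (S.filter fun v => R v φ).card = ∑ v ∈ S, (Φ.filter fun φ => R v φ).card := by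
    simp_rw [Finset.card_filter]
    exact Finset.sum_comm
  have h4 : (∑ v ∈ S, ((Φ.filter fun φ => R v φ).card : ℝ)) ≤ Φ.card * M := by
    rw [← Nat.cast_sum, ← h3]
    exact_mod_cast (Finset.sum_le_card_nsmul _ _ _ h1)
  simp_rw [h2] at h4
  rw [← Finset.mul_sum, hΦ, Nat.cast_pow] at h4
  exact le_of_mul_le_mul_left h4 (by positivity)

-- All of `T` lies in the ball of radius two around one of its members, where paths of length two
-- run through low-degree vertices only.
open Classical in
theorem card_le_of_pairwise_close {V : Type*} [Fintype V] (G : SimpleGraph V) (D : ℕ)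
    (L T : Finset V) (hL : ∀ v ∈ L, G.degree v ≤ D) (hT : T ⊆ L)
    (h : ∀ u ∈ T, ∀ v ∈ T, u ≠ v → G.Adj u v ∨ ∃ w ∈ L, G.Adj u w ∧ G.Adj v w) :
    T.card ≤ 1 + D + D * D := by
  rcases T.eq_empty_or_nonempty with rfl | ⟨u, hu⟩
  · simp
  have hsub : T ⊆ {u} ∪ G.neighborFinset u ∪
      ((G.neighborFinset u).filter (· ∈ L)).biUnion fun w => G.neighborFinset w := by
    intro v hv
    simp only [Finset.mem_union, Finset.mem_singleton, Finset.mem_biUnion, Finset.mem_filter,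
      SimpleGraph.mem_neighborFinset]
    by_cases huv : v = u
    · exact Or.inl (Or.inl huv)
    · rcases h u hu v hv (Ne.symm huv) with h | ⟨w, hw, h1, h2⟩
      · exact Or.inl (Or.inr h)
      · exact Or.inr ⟨w, ⟨h1, hw⟩, h2.symm⟩
  have hdu : (G.neighborFinset u).card ≤ D := by
    rw [SimpleGraph.card_neighborFinset_eq_degree]; exact hL u (hT hu)
  refine (Finset.card_le_card hsub).trans ((Finset.card_union_le _ _).trans ?_)
  refine add_le_add ((Finset.card_union_le _ _).trans ?_) ?_
  · simpa using hdu
  · refine Finset.card_biUnion_le_card_mul _ _ D ?_ |>.trans ?_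
    · intro w hw
      rw [SimpleGraph.card_neighborFinset_eq_degree]
      exact hL w (Finset.mem_filter.1 hw).2
    · exact Nat.mul_le_mul_right _ ((Finset.card_filter_le _ _).trans hdu)

-- Here `N` is the number of vertices of degree at most `D`. The first inequality says that
-- high-degree vertices are expensive; the second is the random choice argument for each `A`, summed
-- over `A`.
open Classical in
theorem IsRainbowSaturated.card_mul_log_le {V : Type*} [Fintype V] {s t : ℕ} (hs : 3 ≤ s)
    (hst : s ≤ t + 1) {G : SimpleGraph V} {c : Sym2 V → Fin t}
    (hG : IsRainbowSaturated (⊤ : SimpleGraph (Fin s)) G c) (D : ℕ) :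
    ∃ N : ℕ, D * Fintype.card V ≤ D * N + 2 * G.edgeSet.ncard ∧
      (t : ℝ) * (N * Real.log (N / (1 + D + D * D))) ≤
        ((t : ℝ) - s + 2) * Real.log ((t : ℝ) - s + 2) * G.edgeSet.ncard := by
  let H : Finset V := Finset.univ.filter fun v => D < G.degree v
  let L : Finset V := Finset.univ.filter fun v => G.degree v ≤ D
  have hedge : G.edgeSet.ncard = G.edgeFinset.card := by
    rw [← SimpleGraph.coe_edgeFinset, Set.ncard_coe_finset]
  have hHL : H.card + L.card = Fintype.card V := by
    have := Finset.card_filter_add_card_filter_not (s := (Finset.univ : Finset V))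
      (fun v => D < G.degree v)
    simpa [H, L] using this
  have hq : ((t + 2 - s : ℕ) : ℝ) = (t : ℝ) - s + 2 := by
    rw [Nat.cast_sub (by omega)]; push_cast; ring
  refine ⟨L.card, ?_, ?_⟩
  · have h1 : D * H.card ≤ ∑ v ∈ H, G.degree v := by
      rw [mul_comm, ← smul_eq_mul]
      exact Finset.card_nsmul_le_sum _ _ _ fun v hv => (Finset.mem_filter.1 hv).2.le
    have h2 : ∑ v ∈ H, G.degree v ≤ 2 * G.edgeFinset.card := by
      rw [← G.sum_degrees_eq_twice_card_edges]
      exact Finset.sum_le_sum_of_subset (Finset.subset_univ _)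
    rw [hedge, ← hHL]
    nlinarith
  -- Since `L` and `H` are disjoint, each edge between them gives exactly one ordered pair.
  let E : Finset (V × V) := (L ×ˢ H).filter fun p => G.Adj p.1 p.2
  have hE : E.card ≤ G.edgeFinset.card := by
    refine Finset.card_le_card_of_injOn (fun p => s(p.1, p.2)) ?_ ?_
    · intro p hp
      simp only [E, Finset.coe_filter, Set.mem_ofPred_eq] at hp
      simpa using hp.2
    · rintro ⟨a, b⟩ hp ⟨a', b'⟩ hp' h
      simp only [E, L, H, Finset.coe_filter, Finset.mem_product, Finset.mem_filter,
        Finset.mem_univ, true_and, Set.mem_ofPred_eq] at hp hp'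
      simp only [Sym2.eq_iff] at h
      rcases h with h | h
      · exact Prod.ext h.1 h.2
      · obtain ⟨rfl, rfl⟩ := h
        omega
  let d : Finset (Fin t) → V → ℕ := fun A v => (H.filter fun w => G.Adj v w ∧ c s(v, w) ∈ Aᶜ).card
  have hA : ∀ A ∈ Finset.powersetCard (s - 2) (Finset.univ : Finset (Fin t)),
      (L.card : ℝ) * Real.log (L.card / (1 + D + D * D)) ≤
        Real.log ((t : ℝ) - s + 2) * ∑ v ∈ L, (d A v : ℝ) := by
    intro A hA
    have hAc : A.card = s - 2 := (Finset.mem_powersetCard.1 hA).2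
    have hAq : (Aᶜ).card = t + 2 - s := by
      rw [Finset.card_compl, hAc, Fintype.card_fin]; omega
    have hne : (Aᶜ).Nonempty := Finset.card_pos.1 (by omega)
    have := sum_inv_pow_le G c H L Aᶜ hne (1 + D + D * D) (by
      intro T hTL hT
      refine card_le_of_pairwise_close G D L T (fun v hv => (Finset.mem_filter.1 hv).2) hTL ?_
      intro u hu v hv huv
      by_contra hcon
      push Not at hcon
      obtain ⟨w, h1, h2, h3, h4, h5⟩ := hG.exists_common_neighbor huv hcon.1 hAc hs
      by_cases hw : w ∈ H
      · exact h3 (hT u hu v hv w hw h1 h2 (by simpa using h4) (by simpa using h5))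
      · exact hcon.2 w (by simpa [H, L] using hw) h1 h2)
    rw [hAq, hq] at this
    refine card_mul_log_le_of_sum_inv_pow_le L (d A) ?_ (by positivity) (by simpa [d] using this)
    rw [← hq]
    exact_mod_cast (show 1 ≤ t + 2 - s by omega)
  have hsum : ∑ A ∈ Finset.powersetCard (s - 2) (Finset.univ : Finset (Fin t)), ∑ v ∈ L, d A v =
      E.card * (t - 1).choose (s - 2) := by
    have h1 : ∀ A, ∑ v ∈ L, d A v = ∑ p ∈ E, if c s(p.1, p.2) ∈ A then 0 else 1 := by
      intro A
      simp only [d, E]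
      rw [Finset.sum_filter (s := L ×ˢ H), Finset.sum_product]
      refine Finset.sum_congr rfl fun v _ => ?_
      rw [Finset.card_filter]
      refine Finset.sum_congr rfl fun w _ => ?_
      by_cases h1 : G.Adj v w <;> by_cases h2 : c s(v, w) ∈ A <;> simp [h1, h2]
    simp_rw [h1]
    rw [Finset.sum_comm, ← smul_eq_mul, ← Finset.sum_const]
    refine Finset.sum_congr rfl fun p _ => ?_
    have h2 : (Finset.powersetCard (s - 2) (Finset.univ : Finset (Fin t))).filter
        (fun A => c s(p.1, p.2) ∉ A) =
        Finset.powersetCard (s - 2) (Finset.univ.erase (c s(p.1, p.2))) := by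
      ext A
      simp only [Finset.mem_filter, Finset.mem_powersetCard, Finset.subset_univ, true_and,
        Finset.subset_erase]
      tauto
    have h3 := congrArg Finset.card h2
    rw [Finset.card_powersetCard, Finset.card_erase_of_mem (Finset.mem_univ _), Finset.card_univ,
      Fintype.card_fin, Finset.card_filter] at h3
    rw [← h3]
    refine Finset.sum_congr rfl fun A _ => ?_
    by_cases h : c s(p.1, p.2) ∈ A <;> simp [h]
  have htot := Finset.sum_le_sum hA
  rw [Finset.sum_const, Finset.card_powersetCard, Finset.card_univ, Fintype.card_fin, nsmul_eq_mul,
    ← Finset.mul_sum] at htot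
  have hsum' : ∑ A ∈ Finset.powersetCard (s - 2) (Finset.univ : Finset (Fin t)),
      ∑ v ∈ L, (d A v : ℝ) = E.card * ((t - 1).choose (s - 2) : ℕ) := by exact_mod_cast hsum
  rw [hsum'] at htot
  -- A fixed colour is avoided by a proportion `(t-s+2)/t` of the sets `A`.
  have hch : ((t - 1).choose (s - 2) : ℝ) * t = t.choose (s - 2) * ((t : ℝ) - s + 2) := by
    have := Nat.choose_mul_succ_eq (t - 1) (s - 2)
    rw [show t - 1 + 1 = t by omega, show t - (s - 2) = t + 2 - s by omega] at this
    rw [← hq]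
    exact_mod_cast this
  have hpos : (0 : ℝ) < t.choose (s - 2) := by
    exact_mod_cast Nat.choose_pos (by omega)
  have hlog : 0 ≤ Real.log ((t : ℝ) - s + 2) := by rw [← hq]; exact Real.log_natCast_nonneg _
  have hq0 : (0 : ℝ) ≤ (t : ℝ) - s + 2 := by rw [← hq]; positivity
  have hE' : (E.card : ℝ) ≤ G.edgeSet.ncard := by rw [hedge]; exact_mod_cast hE
  refine le_of_mul_le_mul_left ?_ hpos
  calc (t.choose (s - 2) : ℝ) * (t * (L.card * Real.log (L.card / (1 + D + D * D))))
      = t * (t.choose (s - 2) * (L.card * Real.log (L.card / (1 + D + D * D)))) := by ring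
    _ ≤ t * (Real.log ((t : ℝ) - s + 2) * (E.card * ((t - 1).choose (s - 2) : ℕ))) := by
        gcongr
    _ = Real.log ((t : ℝ) - s + 2) * E.card * (((t - 1).choose (s - 2) : ℝ) * t) := by ring
    _ = t.choose (s - 2) * (((t : ℝ) - s + 2) * Real.log ((t : ℝ) - s + 2) * E.card) := by
        rw [hch]; ring
    _ ≤ _ := by gcongr

end Lower

/-! ### Asymptotic form of the lower bound -/

section LowerAsymptotics

theorem exists_log_growth_bounds (C : ℝ) {η : ℝ} (hη : 0 < η) (hη1 : η < 1) :
    ∀ᶠ n : ℕ in atTop, 1 ≤ Real.log n ∧ C ≤ η * Real.log n ∧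
      12 * Real.log n ^ 4 ≤ (1 - η) * (n : ℝ) ^ η := by
  have hlog : Tendsto (fun n : ℕ => Real.log n) atTop atTop :=
    Real.tendsto_log_atTop.comp tendsto_natCast_atTop_atTop
  have h3 := ((isLittleO_log_rpow_rpow_atTop 4 hη).bound
    (show 0 < (1 - η) / 12 by linarith)).natCast_atTop
  filter_upwards [hlog.eventually_ge_atTop 1, hlog.eventually_ge_atTop (C / η), h3]
    with n h1 h2 h3
  refine ⟨h1, ?_, ?_⟩
  · rw [div_le_iff₀ hη] at h2; linarith
  · have e : Real.log n ^ (4 : ℝ) = Real.log n ^ 4 := by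
      exact_mod_cast Real.rpow_natCast (Real.log n) 4
    rw [e, Real.norm_of_nonneg (by positivity), Real.norm_of_nonneg (by positivity)] at h3
    linarith

theorem coeff_pos {s t : ℕ} (hs : 3 ≤ s) (ht : s.choose 2 ≤ t) :
    s ≤ t ∧ 0 < ((t : ℝ) - s + 2) * Real.log ((t : ℝ) - s + 2) := by
  have hst : s ≤ t := by
    refine le_trans ?_ ht
    obtain ⟨k, rfl⟩ := Nat.exists_eq_add_of_le' hs
    rw [Nat.choose_succ_succ' (k + 2) 1, Nat.choose_one_right]
    have := Nat.choose_pos (show 1 + 1 ≤ k + 2 by omega)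
    omega
  have : (s : ℝ) ≤ t := by exact_mod_cast hst
  exact ⟨hst, mul_pos (by linarith) (Real.log_pos (by linarith))⟩

theorem eventually_le_rsat {s t : ℕ} (hs : 3 ≤ s) (ht : s.choose 2 ≤ t) {δ : ℝ} (hδ : 0 < δ)
    (hδ1 : δ < 1) :
    ∀ᶠ n : ℕ in atTop,
      (1 - δ) * (t / (((t : ℝ) - s + 2) * Real.log ((t : ℝ) - s + 2)) * (n * Real.log n)) ≤
        rsat t n (⊤ : SimpleGraph (Fin s)) := by
  obtain ⟨hst, hQ⟩ := coeff_pos hs ht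
  set Q := ((t : ℝ) - s + 2) * Real.log ((t : ℝ) - s + 2) with hQdef
  have hA : 0 ≤ t / Q := by positivity
  filter_upwards [exists_log_growth_bounds (2 * (t / Q)) (η := δ / 2) (by linarith)
    (by linarith), eventually_gt_atTop 0] with n hn hn0
  obtain ⟨hL, hLC, hLD⟩ := hn
  have hn0' : (0 : ℝ) < n := by exact_mod_cast hn0
  obtain ⟨G, c, hG, hm⟩ := exists_rsat_eq (t := t) n hs (by omega)
  rw [← hm]
  -- The threshold `log² n` is far above the average degree `O(log n)` of a counterexample, so
  -- almost all vertices are low, yet `1 + D + D²` stays below a small power of `n`.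
  obtain ⟨N, hN, hNlog⟩ := hG.card_mul_log_le hs (by omega) ⌈Real.log n ^ 2⌉₊
  set m := G.edgeSet.ncard
  set D := ⌈Real.log n ^ 2⌉₊
  set L := Real.log n
  have hD1 : L ^ 2 ≤ D := Nat.le_ceil _
  have hD2 : (D : ℝ) ≤ 2 * L ^ 2 := by
    have := (Nat.ceil_lt_add_one (sq_nonneg L)).le
    change (D : ℝ) ≤ _ at this
    nlinarith
  have hL2 : 1 ≤ L ^ 2 := one_le_pow₀ hL
  have hDpos : (0 : ℝ) < D := by linarith
  have hN' : (D : ℝ) * n ≤ D * N + 2 * m := by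
    have : ((D * Fintype.card (Fin n) : ℕ) : ℝ) ≤ ((D * N + 2 * m : ℕ) : ℝ) := by exact_mod_cast hN
    simpa using this
  by_contra hcon
  push Not at hcon
  have hmlt : (m : ℝ) ≤ t / Q * (n * L) := by
    refine hcon.le.trans ?_
    refine mul_le_of_le_one_left (by positivity) (by linarith)
  have hNn : (1 - δ / 2) * n ≤ N := by
    refine le_of_mul_le_mul_left ?_ hDpos
    have h1 : 2 * (t / Q) * L ≤ δ / 2 * D := by nlinarith
    nlinarith
  have hMn : 1 + (D : ℝ) + D * D ≤ (1 - δ / 2) * (n : ℝ) ^ (δ / 2) := by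
    have hD3 : (1 : ℝ) ≤ D := hL2.trans hD1
    have : (D : ℝ) * D ≤ (2 * L ^ 2) * (2 * L ^ 2) := by gcongr
    nlinarith
  have hM0 : 0 < 1 + (D : ℝ) + D * D := by positivity
  have hdiv : (n : ℝ) ^ (1 - δ / 2) ≤ N / (1 + D + D * D) := by
    rw [le_div_iff₀ hM0]
    calc (n : ℝ) ^ (1 - δ / 2) * (1 + D + D * D)
        ≤ (n : ℝ) ^ (1 - δ / 2) * ((1 - δ / 2) * (n : ℝ) ^ (δ / 2)) := by gcongr
      _ = (1 - δ / 2) * ((n : ℝ) ^ (1 - δ / 2) * (n : ℝ) ^ (δ / 2)) := by ring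
      _ = (1 - δ / 2) * n := by rw [← Real.rpow_add hn0']; simp
      _ ≤ N := hNn
  have hlog : (1 - δ / 2) * L ≤ Real.log (N / (1 + D + D * D)) := by
    rw [← Real.log_rpow hn0']
    exact Real.log_le_log (by positivity) hdiv
  have hfin : (t : ℝ) * (((1 - δ / 2) * n) * ((1 - δ / 2) * L)) ≤ Q * m := by
    refine le_trans ?_ hNlog
    have : 0 ≤ (1 - δ / 2) * L := mul_nonneg (by linarith) (by linarith)
    gcongr
  have h5 : t * ((1 - δ) * (n * L)) ≤ Q * m := by
    refine le_trans ?_ hfin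
    have : (1 - δ) * (n * L) ≤ (((1 - δ / 2) * n) * ((1 - δ / 2) * L)) := by
      have h0 : 0 ≤ n * L := by positivity
      nlinarith [sq_nonneg δ, mul_nonneg (sq_nonneg δ) h0]
    gcongr
  have h6 : (1 - δ) * (t / Q * (n * L)) = t * ((1 - δ) * (n * L)) / Q := by ring
  rw [h6, lt_div_iff₀ hQ] at hcon
  linarith

end LowerAsymptotics

/-! ### Greedy completion, cores, and the `O(n log n)` bound -/

section UpperFramework

open Classical in
theorem IsRainbowSaturated.comap_equiv {V V' W K : Type*} {F : SimpleGraph W} {G : SimpleGraph V}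
    {c : Sym2 V → K} (hG : IsRainbowSaturated F G c) (e : V' ≃ V) :
    IsRainbowSaturated F (G.comap e) (fun p => c (p.map e)) := by
  refine ⟨fun h => hG.1 (h.mono e e.injective (fun _ _ h => h) fun _ _ _ => rfl), ?_⟩
  intro u v huv hadj a
  refine (hG.2 (e u) (e v) (e.injective.ne huv) hadj a).mono e.symm e.symm.injective ?_ ?_
  · intro x y hxy
    simp only [SimpleGraph.sup_adj, SimpleGraph.edge_adj, SimpleGraph.comap_adj,
      Equiv.apply_symm_apply, Equiv.symm_apply_eq, EmbeddingLike.apply_eq_iff_eq, ne_eq] at hxy ⊢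
    exact hxy
  · intro x y _
    by_cases h : s(x, y) = s(e u, e v)
    · have h' : s(e.symm x, e.symm y) = s(u, v) := by
        rw [Sym2.eq_iff] at h ⊢
        simpa only [Equiv.symm_apply_eq] using h
      rw [h, h', Function.update_self, Function.update_self]
    · have h' : s(e.symm x, e.symm y) ≠ s(u, v) := by
        rw [Sym2.eq_iff] at h
        rw [ne_eq, Sym2.eq_iff]
        simpa only [Equiv.symm_apply_eq] using h
      rw [Function.update_of_ne h, Function.update_of_ne h']
      simp

theorem IsRainbowSaturated.rsat_le {V W : Type*} [Fintype V] {F : SimpleGraph W} {t n : ℕ}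
    {G : SimpleGraph V} {c : Sym2 V → Fin t} (hG : IsRainbowSaturated F G c)
    (hn : Fintype.card V = n) : rsat t n F ≤ G.edgeSet.ncard := by
  let e : Fin n ≃ V := (Fintype.equivFinOfCardEq hn).symm
  refine le_trans (b := (G.comap e).edgeSet.ncard) (Nat.sInf_le ?_) ?_
  · exact ⟨G.comap e, _, hG.comap_equiv e, rfl⟩
  refine Set.ncard_le_ncard_of_injOn (Sym2.map e) ?_ (Sym2.map.injective e.injective).injOn
    (Set.toFinite _)
  intro p
  induction p with
  | _ x y => exact fun h => h

open Classical in
/-- Greedy completion: a coloured graph without a rainbow copy of `F`, all of whose missing edges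
outside `E` already create such a copy in every colour, extends to a saturated graph inside `E`. -/
theorem rsat_le_ncard {V W : Type*} [Fintype V] {F : SimpleGraph W} {t n : ℕ}
    {G : SimpleGraph V} {c : Sym2 V → Fin t} (hn : Fintype.card V = n)
    (hno : ¬ HasRainbowCopy F G c) (E : Set (Sym2 V))
    (hE : ∀ u v, u ≠ v → s(u, v) ∉ E → ∀ a,
      HasRainbowCopy F (G ⊔ SimpleGraph.edge u v) (Function.update c s(u, v) a)) :
    rsat t n F ≤ E.ncard := by
  -- An edge-maximal rainbow-free extension is saturated. It has no edge outside `E`, since in its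
  -- own colour that edge would already complete a rainbow copy.
  let S : Set (SimpleGraph V × (Sym2 V → Fin t)) :=
    {p | G ≤ p.1 ∧ (∀ e ∈ G.edgeSet, p.2 e = c e) ∧ ¬ HasRainbowCopy F p.1 p.2}
  obtain ⟨⟨G', c'⟩, ⟨hle, hc, hno'⟩, hmax⟩ := Set.exists_max_image S
    (fun p => p.1.edgeSet.ncard) (Set.toFinite S) ⟨(G, c), le_rfl, fun _ _ => rfl, hno⟩
  have hsat : IsRainbowSaturated F G' c' := by
    refine ⟨hno', fun u v huv hadj a => ?_⟩
    by_contra hcon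
    have hmem : (G' ⊔ SimpleGraph.edge u v, Function.update c' s(u, v) a) ∈ S := by
      refine ⟨hle.trans le_sup_left, fun e he => ?_, hcon⟩
      have : e ≠ s(u, v) := by
        rintro rfl
        exact hadj (hle he)
      exact (Function.update_of_ne this _ _).trans (hc e he)
    refine absurd (hmax _ hmem) (not_le.2 (Set.ncard_lt_ncard ?_ (Set.toFinite _)))
    refine ⟨SimpleGraph.edgeSet_mono le_sup_left, fun h => hadj ?_⟩
    have : s(u, v) ∈ (G' ⊔ SimpleGraph.edge u v).edgeSet := by
      rw [SimpleGraph.mem_edgeSet, SimpleGraph.sup_adj, SimpleGraph.edge_adj]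
      exact Or.inr ⟨Or.inl ⟨rfl, rfl⟩, huv⟩
    exact h this
  refine (hsat.rsat_le hn).trans (Set.ncard_le_ncard ?_ (Set.toFinite _))
  intro e
  induction e with
  | _ x y =>
    intro hxy
    by_contra hnE
    rw [SimpleGraph.mem_edgeSet] at hxy
    refine hno' ((hE x y hxy.ne hnE (c' s(x, y))).mono id Function.injective_id ?_ ?_)
    · intro u v huv
      rw [SimpleGraph.sup_adj, SimpleGraph.edge_adj] at huv
      rcases huv with h | ⟨⟨rfl, rfl⟩ | ⟨rfl, rfl⟩, -⟩
      · exact hle h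
      · exact hxy
      · exact hxy.symm
    · intro u v huv
      simp only [id]
      by_cases h : s(u, v) = s(x, y)
      · rw [h, Function.update_self]
      · rw [Function.update_of_ne h]
        rw [SimpleGraph.sup_adj, SimpleGraph.edge_adj] at huv
        rcases huv with h' | ⟨h', -⟩
        · exact hc _ h'
        · exact absurd (Sym2.eq_iff.2 h') h

/-- The graph obtained from a graph on `ι` by adding an independent set `κ` completely joined
to `ι`. -/
def coneGraph {ι : Type*} (H : SimpleGraph ι) (κ : Type*) : SimpleGraph (ι ⊕ κ) where
  Adj
    | .inl i, .inl j => H.Adj i j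
    | .inr _, .inr _ => False
    | _, _ => True
  symm := ⟨by
    rintro (i | u) (j | v) h
    · exact SimpleGraph.Adj.symm h
    all_goals exact h⟩
  loopless := ⟨by
    rintro (i | u) h
    · exact H.loopless.irrefl i h
    · exact h⟩

/-- The colouring of `coneGraph H κ` given by a colouring of `H` and by a word over `ι` for each
element of `κ`. -/
def coneColoring {ι κ K : Type*} (cH : Sym2 ι → K) (col : κ → ι → K) (c₀ : K) :
    Sym2 (ι ⊕ κ) → K :=
  Sym2.lift ⟨fun x y => match x, y with
    | .inl i, .inl j => cH s(i, j)
    | .inl i, .inr v => col v i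
    | .inr v, .inl i => col v i
    | .inr _, .inr _ => c₀, by
      rintro (i | u) (j | v)
      · exact congrArg cH Sym2.eq_swap
      all_goals rfl⟩

open Classical in
/-- Upper bound for `rsat` from a `k`-partite core `H` and a family of words over it. -/
theorem rsat_le_mul_of_core {ι κ : Type*} [Fintype ι] [Fintype κ] {k t n : ℕ}
    (ht : 0 < t) (hn : Fintype.card ι + Fintype.card κ = n) (H : SimpleGraph ι) (χ : H.Coloring (Fin k))
    (cH : Sym2 ι → Fin t) (col : κ → ι → Fin t)
    (hcol : ∀ u v, u ≠ v → ∀ a, ∃ (g : Fin k → ι) (C : Sym2 (Fin (k + 2)) → Fin t),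
      Set.InjOn C (⊤ : SimpleGraph (Fin (k + 2))).edgeSet ∧ C s(0, 1) = a ∧
      (∀ x y, x ≠ y → H.Adj (g x) (g y) ∧ cH s(g x, g y) = C s(x.succ.succ, y.succ.succ)) ∧
      (∀ x, col u (g x) = C s(0, x.succ.succ)) ∧ ∀ x, col v (g x) = C s(1, x.succ.succ)) :
    rsat t n (⊤ : SimpleGraph (Fin (k + 2))) ≤ Fintype.card ι * n := by
  let E : Set (Sym2 (ι ⊕ κ)) := Set.range fun p : ι × (ι ⊕ κ) => s(.inl p.1, p.2)
  have hEcard : E.ncard ≤ Fintype.card ι * n := by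
    rw [← hn, ← Fintype.card_sum, ← Fintype.card_prod, ← Nat.card_eq_fintype_card,
      ← Set.ncard_univ]
    simp only [E, ← Set.image_univ]
    exact Set.ncard_image_le (Set.toFinite _)
  refine (rsat_le_ncard (G := coneGraph H κ) (c := coneColoring cH col ⟨0, ht⟩) (by simpa using hn)
    ?_ E ?_).trans hEcard
  · intro h
    obtain ⟨f, hinj, hf, -⟩ := hasRainbowCopy_top_iff.1 h
    -- A proper vertex colouring with `k + 1` colours excludes every `K_{k+2}`, rainbow or not.
    let ψ : ι ⊕ κ → Option (Fin k) := Sum.elim (fun i => some (χ i)) fun _ => none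
    have hψ : ∀ x y, (coneGraph H κ).Adj x y → ψ x ≠ ψ y := by
      rintro (i | u) (j | v) h
      · simpa [ψ] using χ.valid h
      · simp [ψ]
      · simp [ψ]
      · exact h.elim
    have : Function.Injective (ψ ∘ f) := by
      intro x y hxy
      by_contra hne
      exact hψ _ _ (hf x y hne) hxy
    have := Fintype.card_le_of_injective _ this
    simp at this
  · rintro (i | u) (j | v) huv hE a
    · exact absurd ⟨(i, .inl j), rfl⟩ hE
    · exact absurd ⟨(i, .inr v), rfl⟩ hE
    · exact absurd ⟨(j, .inr u), Sym2.eq_swap⟩ hE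
    · have huv' : u ≠ v := fun h => huv (by rw [h])
      obtain ⟨g, C, hC, hCa, hg, hgu, hgv⟩ := hcol u v huv' a
      let f : Fin (k + 2) → ι ⊕ κ :=
        Fin.cons (.inr u) (Fin.cons (.inr v) fun x => .inl (g x))
      have hf : ∀ x y : Fin (k + 2), x ≠ y →
          (coneGraph H κ ⊔ SimpleGraph.edge (.inr u) (.inr v)).Adj (f x) (f y) ∧
          Function.update (coneColoring cH col ⟨0, ht⟩) s(.inr u, .inr v) a s(f x, f y) =
            C s(x, y) := by
        have hsymm : ∀ x y, ((coneGraph H κ ⊔ SimpleGraph.edge (.inr u) (.inr v)).Adj (f x) (f y) ∧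
          Function.update (coneColoring cH col ⟨0, ht⟩) s(.inr u, .inr v) a s(f x, f y) =
            C s(x, y)) → ((coneGraph H κ ⊔ SimpleGraph.edge (.inr u) (.inr v)).Adj (f y) (f x) ∧
          Function.update (coneColoring cH col ⟨0, ht⟩) s(.inr u, .inr v) a s(f y, f x) =
            C s(y, x)) := by
          rintro x y ⟨h1, h2⟩
          exact ⟨h1.symm, by rw [Sym2.eq_swap (a := f y), h2, Sym2.eq_swap]⟩
        have h01 : (coneGraph H κ ⊔ SimpleGraph.edge (.inr u) (.inr v)).Adj (f 0) (f 1) ∧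
          Function.update (coneColoring cH col ⟨0, ht⟩) s(.inr u, .inr v) a s(f 0, f 1) =
            C s(0, 1) := by
          refine ⟨?_, ?_⟩
          · rw [SimpleGraph.sup_adj, SimpleGraph.edge_adj]
            exact Or.inr ⟨Or.inl ⟨rfl, rfl⟩, huv⟩
          · rw [hCa]
            exact Function.update_self _ _ _
        have h0 : ∀ x : Fin k, (coneGraph H κ ⊔ SimpleGraph.edge (.inr u) (.inr v)).Adj
            (f 0) (f x.succ.succ) ∧ Function.update (coneColoring cH col ⟨0, ht⟩)
            s(.inr u, .inr v) a s(f 0, f x.succ.succ) = C s(0, x.succ.succ) := by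
          refine fun x => ⟨Or.inl trivial, ?_⟩
          rw [Function.update_of_ne (by simp [f]), ← hgu]
          rfl
        have h1 : ∀ x : Fin k, (coneGraph H κ ⊔ SimpleGraph.edge (.inr u) (.inr v)).Adj
            (f 1) (f x.succ.succ) ∧ Function.update (coneColoring cH col ⟨0, ht⟩)
            s(.inr u, .inr v) a s(f 1, f x.succ.succ) = C s(1, x.succ.succ) := by
          refine fun x => ⟨Or.inl trivial, ?_⟩
          rw [Function.update_of_ne (by simp [f]), ← hgv]
          rfl
        have h2 : ∀ x y : Fin k, x ≠ y → (coneGraph H κ ⊔ SimpleGraph.edge (.inr u) (.inr v)).Adj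
            (f x.succ.succ) (f y.succ.succ) ∧ Function.update (coneColoring cH col ⟨0, ht⟩)
            s(.inr u, .inr v) a s(f x.succ.succ, f y.succ.succ) = C s(x.succ.succ, y.succ.succ) := by
          refine fun x y hxy => ⟨Or.inl (hg x y hxy).1, ?_⟩
          rw [Function.update_of_ne (by simp [f]), ← (hg x y hxy).2]
          rfl
        intro x y hxy
        cases x using Fin.cases with
        | zero =>
          cases y using Fin.cases with
          | zero => exact absurd rfl hxy
          | succ y =>
            cases y using Fin.cases with
            | zero => exact h01
            | succ y => exact h0 y
        | succ x =>
          cases x using Fin.cases with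
          | zero =>
            cases y using Fin.cases with
            | zero => exact hsymm _ _ h01
            | succ y =>
              cases y using Fin.cases with
              | zero => exact absurd rfl hxy
              | succ y => exact h1 y
          | succ x =>
            cases y using Fin.cases with
            | zero => exact hsymm _ _ (h0 x)
            | succ y =>
              cases y using Fin.cases with
              | zero => exact hsymm _ _ (h1 x)
              | succ y => exact h2 x y fun h => hxy (by rw [h])
      refine hasRainbowCopy_top_iff.2 ⟨f, ?_, fun x y hxy => (hf x y hxy).1, ?_⟩
      · intro x y hxy
        by_contra hne
        exact (hf x y hne).1.ne hxy
      · refine hC.congr ?_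
        intro e
        induction e with
        | _ x y => 
          intro h
          simp only [Sym2.map_mk]
          convert (hf x y (SimpleGraph.Adj.ne ((SimpleGraph.mem_edgeSet _).1 h))).2.symm

-- A transposition of the palette moves the prescribed edge to colour `a` without creating
-- coincidences.
open Classical in
theorem exists_injOn_edgeSet_top {s t : ℕ} (ht : s.choose 2 ≤ t) (e₀ : Sym2 (Fin s)) (a : Fin t) :
    ∃ C : Sym2 (Fin s) → Fin t, Set.InjOn C (⊤ : SimpleGraph (Fin s)).edgeSet ∧ C e₀ = a := by
  have hcard : Fintype.card (⊤ : SimpleGraph (Fin s)).edgeSet ≤ Fintype.card (Fin t) := by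
    rw [← SimpleGraph.edgeFinset_card, SimpleGraph.card_edgeFinset_top_eq_card_choose_two]
    simpa using ht
  obtain ⟨φ⟩ := Function.Embedding.nonempty_of_card_le hcard
  let C : Sym2 (Fin s) → Fin t :=
    fun e => if h : e ∈ (⊤ : SimpleGraph (Fin s)).edgeSet then φ ⟨e, h⟩ else a
  refine ⟨fun e => Equiv.swap (C e₀) a (C e), ?_, Equiv.swap_apply_left _ _⟩
  intro e he e' he' h
  have h' := (Equiv.swap (C e₀) a).injective h
  simp only [C, dif_pos he, dif_pos he'] at h'
  exact congrArg Subtype.val (φ.injective h')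

/-- Words given by binary expansions, over a core consisting of disjoint rainbow cliques. -/
theorem rsat_top_le_clog {k t n : ℕ} (ht : (k + 2).choose 2 ≤ t)
    (hn : t * Nat.clog 2 n * k ≤ n) :
    rsat t n (⊤ : SimpleGraph (Fin (k + 2))) ≤ t * Nat.clog 2 n * k * n := by
  set R := Nat.clog 2 n with hR
  choose C hC hCa using exists_injOn_edgeSet_top ht s(0, 1)
  let ι := (Fin t × Fin R) × Fin k
  have hι : Fintype.card ι = t * R * k := by simp [ι]
  obtain ⟨bit⟩ : Nonempty (Fin (n - t * R * k) ↪ (Fin R → Bool)) := by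
    refine Function.Embedding.nonempty_of_card_le ?_
    have := Nat.le_pow_clog (b := 2) one_lt_two n
    simp only [Fintype.card_fin, Fintype.card_pi, Fintype.card_bool, Finset.prod_const,
      Finset.card_univ]
    exact (Nat.sub_le _ _).trans this
  let H : SimpleGraph ι := SimpleGraph.fromRel fun p q => p.1 = q.1 ∧ p.2 ≠ q.2
  -- Edges of `H` stay inside one clique, so on them the choice of representative in `e.out` does
  -- not matter.
  let cH : Sym2 ι → Fin t := fun e => C e.out.1.1.1 (e.map fun p => p.2.succ.succ)
  let χ : H.Coloring (Fin k) := SimpleGraph.Coloring.mk Prod.snd (by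
    rintro p q ⟨-, h | h⟩
    · exact h.2
    · exact h.2.symm)
  -- In the clique for colour `a` and bit `i`, an outer vertex plays the role of vertex `0` or `1`
  -- of the pattern `C a` according to its bit. Two vertices with different bits complete the
  -- pattern, whose edge `01` has colour `a`.
  let col : Fin (n - t * R * k) → ι → Fin t := fun u p =>
    C p.1.1 s(if bit u p.1.2 then 1 else 0, p.2.succ.succ)
  have hcH : ∀ a i x y, cH s(((a, i), x), ((a, i), y)) = C a s(x.succ.succ, y.succ.succ) := by
    intro a i x y
    have : (Quot.out s((((a, i), x) : ι), ((a, i), y))).1.1.1 = a := by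
      have h := Sym2.out_fst_mem s((((a, i), x) : ι), ((a, i), y))
      rw [Sym2.mem_iff] at h
      rcases h with h | h <;> exact congrArg (fun p : ι => p.1.1) h
    simp only [cH]
    rw [this]
    rfl
  rw [← hι] at hn ⊢
  refine rsat_le_mul_of_core (κ := Fin (n - t * R * k)) (by
    have := Nat.choose_pos (show 2 ≤ k + 2 by omega)
    omega) (by simp only [Fintype.card_fin]; omega) H χ cH col ?_
  intro u v huv a
  obtain ⟨i, hi⟩ : ∃ i, bit u i ≠ bit v i := by
    by_contra hcon
    push Not at hcon
    exact huv (bit.injective (funext hcon))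
  have hswap : ∀ x : Fin k, ∀ b : Bool, ∀ w, bit w i = b →
    col w ((a, i), x) = C a s(if b then 1 else 0, x.succ.succ) := by
    rintro x b w rfl
    rfl
  have hH : ∀ x y : Fin k, x ≠ y → H.Adj ((a, i), x) ((a, i), y) ∧
      cH s(((a, i), x), ((a, i), y)) = C a s(x.succ.succ, y.succ.succ) :=
    fun x y hxy => ⟨⟨by simpa [ι] using hxy, Or.inl ⟨rfl, hxy⟩⟩, hcH a i x y⟩
  cases hu : bit u i
  · have hv : bit v i = true := by rw [hu] at hi; simpa using hi.symm
    exact ⟨fun x => ((a, i), x), C a, hC a, hCa a, hH,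
      fun x => by simpa using hswap x _ u hu, fun x => by simpa using hswap x _ v hv⟩
  · have hv : bit v i = false := by rw [hu] at hi; simpa using hi.symm
    -- Here `u` and `v` play the opposite roles, so the pattern is relabelled.
    let σ : Equiv.Perm (Fin (k + 2)) := Equiv.swap 0 1
    have hσ : ∀ x : Fin k, σ x.succ.succ = x.succ.succ := fun x =>
      Equiv.swap_apply_of_ne_of_ne (Fin.succ_ne_zero _) (by
        rw [← Fin.succ_zero_eq_one]; exact fun h => Fin.succ_ne_zero _ (Fin.succ_injective _ h))
    refine ⟨fun x => ((a, i), x), fun e => C a (e.map σ), ?_, ?_, ?_, ?_, ?_⟩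
    · refine (hC a).comp (Sym2.map.injective σ.injective).injOn ?_
      intro e
      induction e with
      | _ x y => intro h; simpa using h
    · simp only [σ]
      rw [Sym2.map_mk, Equiv.swap_apply_left, Equiv.swap_apply_right, Sym2.eq_swap, hCa]
    · intro x y hxy
      simp only
      rw [Sym2.map_mk, hσ, hσ]
      exact hH x y hxy
    · intro x
      simp only
      rw [Sym2.map_mk, hσ, Equiv.swap_apply_left]
      simpa using hswap x _ u hu
    · intro x
      simp only
      rw [Sym2.map_mk, hσ, Equiv.swap_apply_right]
      simpa using hswap x _ v hv

end UpperFramework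

/-! ### Codes of optimal rate -/

section Code

open Classical in
/-- A large family of functions on a grid, indexed by `A → Fin m`, in which any two members agree,
for each `a : A`, under `φ a` at some point where they differ. -/
theorem exists_grid_family {A X Y : Type*} [Fintype A] [Fintype X] [AddCommGroup Y] [Fintype Y]
    (φ : A → X → Y) (m : ℕ) :
    ∃ C : Finset ((A → Fin m) → X),
      (Fintype.card X : ℝ) ^ m ^ Fintype.card A ≤
        C.card * (Fintype.card Y : ℝ) ^ (m + 1) ^ Fintype.card A ∧
      ∀ x ∈ C, ∀ y ∈ C, x ≠ y → ∀ a, ∃ j, x j ≠ y j ∧ φ a (x j) = φ a (y j) := by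
  -- The check at `p` sums, over `a`, the value under `φ a` at the grid point `p - 1 + e_a`, dropped
  -- if outside the grid. Hence there are only `(m+1)^|A|` checks in total, not `|A|` times `m^|A|`.
  let R : (A → Fin (m + 1)) → A × (A → Fin m) → Prop :=
    fun p q => ∀ b, (q.2 b : ℕ) + 1 = p b + if b = q.1 then 1 else 0
  let σ : ((A → Fin m) → X) → (A → Fin (m + 1)) → Y :=
    fun x p => ∑ q : A × (A → Fin m), if R p q then φ q.1 (x q.2) else 0
  have hY : (0 : ℝ) < Fintype.card Y := by
    exact_mod_cast Fintype.card_pos_iff.2 ⟨0⟩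
  obtain ⟨z, hz⟩ := Fintype.exists_le_card_fiber_of_nsmul_le_card (f := σ)
    (b := (Fintype.card X : ℝ) ^ m ^ Fintype.card A /
      (Fintype.card Y : ℝ) ^ (m + 1) ^ Fintype.card A) (by
      rw [nsmul_eq_mul]
      simp only [Fintype.card_pi, Finset.prod_const, Finset.card_univ, Fintype.card_fin]
      push_cast
      rw [mul_div_cancel₀ _ (by positivity)])
  refine ⟨_, (div_le_iff₀ (by positivity)).1 hz, ?_⟩
  intro x hx y hy hxy a
  have hσ : σ x = σ y := by
    rw [(Finset.mem_filter.1 hx).2, (Finset.mem_filter.1 hy).2]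
  -- In the check at `p = j + 1 - e_a`, the other terms sit at `j - e_a + e_{a'}`, whose
  -- `a`-coordinate is smaller. By minimality `x` and `y` agree there, so equal checks leave
  -- equality at `j` under `φ a`.
  obtain ⟨j, hj, hmin⟩ := Set.exists_min_image {j | x j ≠ y j} (fun j => j a) (Set.toFinite _)
    (Function.ne_iff.1 hxy)
  refine ⟨j, hj, ?_⟩
  let p : A → Fin (m + 1) := fun b => ⟨if b = a then j b else j b + 1, by
    have := (j b).2
    split_ifs <;> omega⟩
  have hp := congrFun hσ p
  rw [← sub_eq_zero] at hp ⊢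
  rw [← hp]
  simp only [σ]
  rw [← Finset.sum_sub_distrib, Finset.sum_eq_single (a, j)]
  · have hR : R p (a, j) := by
      intro b
      by_cases h : b = a <;> simp [p, h]
    rw [if_pos hR, if_pos hR]
  · rintro ⟨a', j'⟩ - hne
    by_cases hR : R p (a', j')
    · rw [if_pos hR, if_pos hR]
      have hxy' : x j' = y j' := by
        by_contra hcon
        have h1 : j a ≤ j' a := hmin j' hcon
        have h1' : (j a : ℕ) ≤ j' a := h1
        have h2 := hR a
        simp only [p, if_true] at h2
        by_cases ha : a = a'
        · subst ha
          refine hne (Prod.ext rfl (funext fun b => Fin.ext ?_))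
          have h3 := hR b
          simp only [p] at h3
          by_cases hb : b = a
          · subst hb; simpa using h3
          · simpa [hb] using h3
        · rw [if_neg ha] at h2
          omega
      rw [hxy', sub_self]
    · rw [if_neg hR, if_neg hR, sub_self]
  · intro h
    exact absurd (Finset.mem_univ _) h

open Classical in
/-- The number of words in which each letter of `A` occurs exactly `r` times. -/
theorem factorial_le_card_balanced_words (A : Type*) [Fintype A] (r : ℕ) :
    (Fintype.card A * r).factorial ≤
      Fintype.card {x : A × Fin r → A // ∀ a, (Finset.univ.filter fun i => x i = a).card = r} *
        r.factorial ^ Fintype.card A := by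
  let X := {x : A × Fin r → A // ∀ a, (Finset.univ.filter fun i => x i = a).card = r}
  have hfst : ∀ a, (Finset.univ.filter fun i : A × Fin r => i.1 = a).card = r := by
    intro a
    have : (Finset.univ.filter fun i : A × Fin r => i.1 = a) = {a} ×ˢ Finset.univ := by
      ext ⟨b, i⟩; simp [eq_comm]
    rw [this, Finset.card_product]
    simp
  let F : Equiv.Perm (A × Fin r) → X := fun π => ⟨fun i => (π i).1, fun a => by
    refine (?_ : _ = _).trans (hfst a)
    refine Finset.card_bij (fun i _ => π i) (by simp) (by simp) ?_
    intro i hi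
    exact ⟨π.symm i, by simpa using hi, by simp⟩⟩
  have hcard : Fintype.card (Equiv.Perm (A × Fin r)) = (Fintype.card A * r).factorial := by
    rw [Fintype.card_perm, Fintype.card_prod, Fintype.card_fin]
  have hstab : Fintype.card {g : Equiv.Perm (A × Fin r) // Prod.fst ∘ g = Prod.fst} =
      r.factorial ^ Fintype.card A := by
    rw [DomMulAct.stabilizer_card]
    rw [Finset.prod_congr rfl (g := fun _ => r.factorial), Finset.prod_const, Finset.card_univ]
    intro a _
    rw [Fintype.card_subtype, hfst a]
  rw [← hcard, ← hstab, mul_comm, ← Finset.card_univ, ← Finset.card_univ (α := X)]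
  refine Finset.card_le_mul_card_image_of_maps_to (f := F) (fun _ _ => Finset.mem_univ _) _ ?_
  intro x _
  rcases (Finset.univ.filter fun π => F π = x).eq_empty_or_nonempty with h | ⟨π₀, hπ₀⟩
  · rw [h]; simp
  rw [Fintype.card_subtype]
  -- A nonempty fibre of `F` is a coset of the stabilizer of `Prod.fst`.
  refine Finset.card_le_card_of_injOn (fun π => π * π₀⁻¹) ?_ (mul_left_injective _).injOn
  intro π hπ
  simp only [Finset.coe_filter, Finset.mem_univ, true_and, Set.mem_ofPred_eq] at hπ ⊢
  have h1 : F π = F π₀ := by rw [hπ, (Finset.mem_filter.1 hπ₀).2]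
  funext i
  have h2 := congrFun (congrArg Subtype.val h1) (π₀⁻¹ i)
  simpa [F] using h2

theorem log_factorial_le {r : ℕ} (hr : 0 < r) :
    Real.log r.factorial ≤ r * Real.log r - r + 1 + Real.log r := by
  induction r, hr using Nat.le_induction with
  | base => simp
  | succ r hr ih =>
    have hr0 : (0 : ℝ) < r := by exact_mod_cast hr
    rw [Nat.factorial_succ, Nat.cast_mul, Real.log_mul (by positivity) (by positivity)]
    push_cast
    have h1 := Real.log_le_sub_one_of_pos (show 0 < (r : ℝ) / (r + 1) by positivity)
    rw [Real.log_div hr0.ne' (by positivity)] at h1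
    have h2 : (r : ℝ) / (r + 1) - 1 = -(1 / (r + 1)) := by field_simp; ring
    rw [h2] at h1
    have h3 : ((r : ℝ) + 1) * (Real.log r - Real.log (r + 1)) ≤ -1 := by
      calc ((r : ℝ) + 1) * (Real.log r - Real.log (r + 1)) ≤ (r + 1) * -(1 / (r + 1)) := by gcongr
        _ = -1 := by field_simp
    linarith

theorem le_log_factorial {n : ℕ} (hn : 0 < n) : n * Real.log n - n ≤ Real.log n.factorial := by
  have hn0 : (0 : ℝ) < n := by exact_mod_cast hn
  have h := Real.pow_div_factorial_le_exp (n : ℝ) hn0.le n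
  have h2 := Real.log_le_log (by positivity) h
  rw [Real.log_exp, Real.log_div (by positivity) (by positivity), Real.log_pow] at h2
  linarith

-- Each grid block is a balanced word of length `t * r`, and `φ a` records its set of `a`-positions.
-- A block contributes `log |X| - log K`, roughly `(t-1) r log(t-1)`; the subtracted term with
-- `(m+1)^t - m^t` pays for the checks in excess of the blocks.
open Classical in
theorem exists_code_of_params {t : ℕ} (ht : 2 ≤ t) {r m : ℕ} (hr : 0 < r) (hm : 0 < m) :
    ∃ (N : ℕ) (w : Fin N → (Fin t → Fin m) × (Fin t × Fin r) → Fin t),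
      (∀ u v, u ≠ v → ∀ a, ∃ i, w u i ≠ w v i ∧ w u i ≠ a ∧ w v i ≠ a) ∧
      (m : ℝ) ^ t * (((t : ℝ) - 1) * (r * Real.log ((t : ℝ) - 1) - (1 + Real.log r))) -
        (((m : ℝ) + 1) ^ t - (m : ℝ) ^ t) * (t * r) ≤ Real.log N := by
  let X := {x : Fin t × Fin r → Fin t // ∀ a, (Finset.univ.filter fun i => x i = a).card = r}
  let P := {S : Finset (Fin t × Fin r) // S ∈ Finset.powersetCard r Finset.univ}
  -- The `r`-subsets are identified with `ZMod K` only to have an additive group in which to form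
  -- checks.
  set K := (t * r).choose r with hK
  have hKpos : 0 < K := Nat.choose_pos (Nat.le_mul_of_pos_left r (by omega))
  have : NeZero K := ⟨hKpos.ne'⟩
  have hP : Fintype.card P = Fintype.card (ZMod K) := by
    rw [ZMod.card, Fintype.card_coe, Finset.card_powersetCard]
    simp [K]
  let e : P ≃ ZMod K := Fintype.equivOfCardEq hP
  let φ : Fin t → X → ZMod K := fun a x =>
    e ⟨Finset.univ.filter fun i => x.1 i = a, Finset.mem_powersetCard.2 ⟨Finset.subset_univ _, x.2 a⟩⟩
  obtain ⟨C, hC, hgood⟩ := exists_grid_family φ m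
  rw [ZMod.card, Fintype.card_fin] at hC
  refine ⟨C.card, fun u q => ((C.equivFin.symm u).1 q.1).1 q.2, ?_, ?_⟩
  · intro u v huv a
    obtain ⟨j, hj, hφ⟩ := hgood _ (C.equivFin.symm u).2 _ (C.equivFin.symm v).2
      (fun h => huv (C.equivFin.symm.injective (Subtype.ext h))) a
    obtain ⟨i, hi⟩ := Function.ne_iff.1 (fun h => hj (Subtype.ext h))
    have hset := congrArg Subtype.val (e.injective hφ)
    have hiff : ((C.equivFin.symm u).1 j).1 i = a ↔ ((C.equivFin.symm v).1 j).1 i = a := by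
      simpa using Finset.ext_iff.1 hset i
    refine ⟨(j, i), hi, ?_, ?_⟩
    · exact fun h => hi (h.trans (hiff.1 h).symm)
    · exact fun h => hi ((hiff.2 h).trans h.symm)
  · have ht1 : ((t - 1 : ℕ) : ℝ) = (t : ℝ) - 1 := by
      rw [Nat.cast_sub (by omega)]; simp
    have ht0 : (0 : ℝ) < (t : ℝ) - 1 := by
      rw [← ht1]; exact_mod_cast (show 0 < t - 1 by omega)
    have hr0 : (0 : ℝ) < r := by exact_mod_cast hr
    have hX : (t * r).factorial ≤ Fintype.card X * r.factorial ^ t := by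
      have := factorial_le_card_balanced_words (Fin t) r
      rw [Fintype.card_fin] at this
      convert this
    have hX0 : 0 < Fintype.card X := by
      rcases Nat.eq_zero_or_pos (Fintype.card X) with h | h
      · rw [h, zero_mul] at hX
        exact absurd hX (not_le.2 (Nat.factorial_pos _))
      · exact h
    have hchoose : (t * r).factorial = K * r.factorial * ((t - 1) * r).factorial := by
      rw [hK, ← Nat.choose_mul_factorial_mul_factorial
        (Nat.le_mul_of_pos_left r (show 0 < t by omega)), Nat.sub_one_mul]
    have hX' : Real.log K + Real.log r.factorial + Real.log ((t - 1) * r).factorial ≤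
        Real.log (Fintype.card X) + t * Real.log r.factorial := by
      rw [hchoose] at hX
      have h1 : ((K * r.factorial * ((t - 1) * r).factorial : ℕ) : ℝ) ≤
        ((Fintype.card X * r.factorial ^ t : ℕ) : ℝ) := by exact_mod_cast hX
      have h2 := Real.log_le_log (by positivity) h1
      push_cast at h2
      rw [Real.log_mul (by positivity) (by positivity), Real.log_mul (by positivity) (by positivity),
        Real.log_mul (by positivity) (by positivity), Real.log_pow] at h2
      exact h2
    have hM : ((t : ℝ) - 1) * (r * Real.log ((t : ℝ) - 1) - (1 + Real.log r)) ≤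
        Real.log (Fintype.card X) - Real.log K := by
      have h1 := log_factorial_le hr
      have h2 := le_log_factorial (n := (t - 1) * r) (Nat.mul_pos (by omega) hr)
      rw [Nat.cast_mul, ht1, Real.log_mul ht0.ne' hr0.ne'] at h2
      have h3 := mul_le_mul_of_nonneg_left h1 ht0.le
      linarith
    have hKlog : Real.log K ≤ t * r := by
      have h1 : (K : ℝ) ≤ 2 ^ (t * r) := by exact_mod_cast Nat.choose_le_two_pow _ _
      have h2 := Real.log_le_log (by positivity) h1
      rw [Real.log_pow] at h2
      push_cast at h2
      have h3 := Real.log_two_lt_d9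
      have : (t : ℝ) * r * Real.log 2 ≤ t * r * 1 := by gcongr; linarith
      linarith
    have hC0 : (0 : ℝ) < C.card := by
      by_contra hcon
      have : (C.card : ℝ) = 0 := le_antisymm (not_lt.1 hcon) (by positivity)
      rw [this, zero_mul] at hC
      exact absurd hC (not_le.2 (by positivity))
    have hClog := Real.log_le_log (by positivity) hC
    rw [Real.log_mul hC0.ne' (by positivity), Real.log_pow, Real.log_pow] at hClog
    push_cast at hClog
    have h5 := mul_le_mul_of_nonneg_left hM (show (0 : ℝ) ≤ (m : ℝ) ^ t by positivity)
    have h6 : (0 : ℝ) ≤ ((m : ℝ) + 1) ^ t - (m : ℝ) ^ t := by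
      rw [sub_nonneg]; gcongr; linarith
    have h7 := mul_le_mul_of_nonneg_left hKlog h6
    linarith

/-- Large `r` absorbs the factorial estimates and large `m` the boundary of the grid, each costing
at most `ε / 2` of the rate. -/
theorem exists_code {t : ℕ} (ht : 2 ≤ t) {ε : ℝ} (hε : 0 < ε) :
    ∃ (L N : ℕ) (w : Fin N → Fin L → Fin t), 0 < L ∧
      (∀ u v, u ≠ v → ∀ a, ∃ i, w u i ≠ w v i ∧ w u i ≠ a ∧ w v i ≠ a) ∧
      L * (((t : ℝ) - 1) / t * Real.log ((t : ℝ) - 1) - ε) ≤ Real.log N := by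
  have ht0 : (0 : ℝ) < t := by exact_mod_cast (show 0 < t by omega)
  have hlim1 : Tendsto (fun r : ℕ => ((t : ℝ) - 1) / t * ((1 + Real.log r) / r)) atTop (𝓝 0) := by
    have h1 : Tendsto (fun r : ℕ => Real.log r / r) atTop (𝓝 0) :=
      (Real.isLittleO_log_id_atTop.tendsto_div_nhds_zero).comp tendsto_natCast_atTop_atTop
    have h2 : Tendsto (fun r : ℕ => (1 : ℝ) / r) atTop (𝓝 0) := tendsto_one_div_atTop_nhds_zero_nat
    have h3 := (h2.add h1).const_mul (((t : ℝ) - 1) / t)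
    simpa [add_div] using h3
  have hlim2 : Tendsto (fun m : ℕ => (1 + 1 / (m : ℝ)) ^ t - 1) atTop (𝓝 0) := by
    have h2 : Tendsto (fun r : ℕ => (1 : ℝ) / r) atTop (𝓝 0) := tendsto_one_div_atTop_nhds_zero_nat
    have h3 := ((h2.const_add 1).pow t).sub_const 1
    simpa using h3
  obtain ⟨r, hr, hr0⟩ :=
    ((hlim1.eventually_lt_const (show 0 < ε / 2 by linarith)).and (eventually_gt_atTop 0)).exists
  obtain ⟨m, hm, hm0⟩ :=
    ((hlim2.eventually_lt_const (show 0 < ε / 2 by linarith)).and (eventually_gt_atTop 0)).exists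
  have hr0' : (0 : ℝ) < r := by exact_mod_cast hr0
  have hm0' : (0 : ℝ) < m := by exact_mod_cast hm0
  obtain ⟨N, w, hw, hN⟩ := exists_code_of_params ht hr0 hm0
  let e := Fintype.equivFin ((Fin t → Fin m) × (Fin t × Fin r))
  have hcard : Fintype.card ((Fin t → Fin m) × (Fin t × Fin r)) = m ^ t * (t * r) := by simp
  refine ⟨_, N, fun u i => w u (e.symm i), ?_, ?_, ?_⟩
  · rw [hcard]; positivity
  · intro u v huv a
    obtain ⟨i, hi⟩ := hw u v huv a
    exact ⟨e i, by simpa using hi⟩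
  · refine le_trans ?_ hN
    rw [hcard]
    push_cast
    have h1 : ((m : ℝ) + 1) ^ t = (m : ℝ) ^ t * (1 + 1 / (m : ℝ)) ^ t := by
      rw [← mul_pow]; congr 1; field_simp
    have h2 : (m : ℝ) ^ t * (((t : ℝ) - 1) * (r * Real.log ((t : ℝ) - 1) - (1 + Real.log r))) -
        (((m : ℝ) + 1) ^ t - (m : ℝ) ^ t) * (t * r) = (m : ℝ) ^ t * (t * r) *
        (((t : ℝ) - 1) / t * Real.log ((t : ℝ) - 1) - ((t : ℝ) - 1) / t * ((1 + Real.log r) / r)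
          - ((1 + 1 / (m : ℝ)) ^ t - 1)) := by
      rw [h1]; field_simp
    rw [h2]
    exact mul_le_mul_of_nonneg_left (by linarith) (by positivity)

end Code

/-! ### Upper bounds for triangles and the order of magnitude -/

section Final

/-- A code over `t` letters, concatenated with itself, gives a bipartite graph with few edges that
is nearly rainbow triangle saturated. -/
theorem rsat_triangle_le_of_code {t L N n : ℕ} (ht : 0 < t) (hN : 2 ≤ N)
    (w : Fin N → Fin L → Fin t)
    (hw : ∀ u v, u ≠ v → ∀ a, ∃ i, w u i ≠ w v i ∧ w u i ≠ a ∧ w v i ≠ a)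
    (hn : L * Nat.clog N n ≤ n) :
    rsat t n (⊤ : SimpleGraph (Fin 3)) ≤ L * Nat.clog N n * n := by
  set Q := Nat.clog N n with hQ
  obtain ⟨f⟩ : Nonempty (Fin (n - L * Q) ↪ (Fin Q → Fin N)) := by
    refine Function.Embedding.nonempty_of_card_le ?_
    have := Nat.le_pow_clog (b := N) hN n
    simp only [Fintype.card_fin, Fintype.card_pi, Finset.prod_const, Finset.card_univ]
    exact (Nat.sub_le _ _).trans this
  have hι : Fintype.card (Fin L × Fin Q) = L * Q := by simp
  rw [← hι]
  refine rsat_le_mul_of_core (k := 1) (κ := Fin (n - L * Q)) ht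
    (by simp only [hι, Fintype.card_fin]; omega) (⊥ : SimpleGraph (Fin L × Fin Q))
    (SimpleGraph.Coloring.mk (fun _ => 0) (by simp)) (fun _ => ⟨0, ht⟩)
    (fun u p => w (f u p.2) p.1) ?_
  intro u v huv a
  obtain ⟨j, hj⟩ := Function.ne_iff.1 (f.injective.ne huv)
  obtain ⟨i, h1, h2, h3⟩ := hw _ _ hj a
  let C : Sym2 (Fin 3) → Fin t := fun e =>
    if e = s(0, 1) then a else if e = s(0, 2) then w (f u j) i else w (f v j) i
  have h01 : C s(0, 1) = a := rfl
  have h02 : C s(0, 2) = w (f u j) i := rfl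
  have h12 : C s(1, 2) = w (f v j) i := rfl
  have hedge : ∀ e ∈ (⊤ : SimpleGraph (Fin 3)).edgeSet, e = s(0, 1) ∨ e = s(0, 2) ∨ e = s(1, 2) := by
    intro e
    induction e with
    | _ x y =>
      rw [SimpleGraph.mem_edgeSet, SimpleGraph.top_adj]
      revert x y
      decide
  refine ⟨fun _ => (i, j), C, ?_, h01, ?_, ?_, ?_⟩
  · intro e he e' he' h
    rcases hedge e he with rfl | rfl | rfl <;> rcases hedge e' he' with rfl | rfl | rfl <;>
      first
      | rfl
      | (simp only [h01, h02, h12] at h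
         first
         | exact absurd h h1
         | exact absurd h.symm h1
         | exact absurd h h2
         | exact absurd h.symm h2
         | exact absurd h h3
         | exact absurd h.symm h3)
  · intro x y hxy
    exact absurd (Subsingleton.elim x y) hxy
  · intro x
    rw [Subsingleton.elim x 0]
    exact h02.symm
  · intro x
    rw [Subsingleton.elim x 0]
    exact h12.symm

theorem clog_le_log_div_add_one {N n : ℕ} (hN : 2 ≤ N) (hn : 0 < n) :
    (Nat.clog N n : ℝ) ≤ Real.log n / Real.log N + 1 := by
  rw [← Real.natCeil_logb_natCast]
  refine (Nat.ceil_lt_add_one ?_).le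
  refine Real.logb_nonneg ?_ ?_
  · exact_mod_cast (show 1 < N by omega)
  · exact_mod_cast (show 1 ≤ n from hn)

theorem eventually_mul_clog_le {N : ℕ} (hN : 2 ≤ N) (c : ℕ) :
    ∀ᶠ n : ℕ in atTop, c * Nat.clog N n ≤ n := by
  have hlogN : 0 < Real.log N := Real.log_pos (by exact_mod_cast (show 1 < N by omega))
  have h1 := (Real.isLittleO_log_id_atTop.bound
    (show 0 < Real.log N / (2 * c + 1) by positivity)).natCast_atTop
  filter_upwards [h1, eventually_ge_atTop (2 * c), eventually_gt_atTop 0] with n h1 h2 hn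
  have hn1 : (1 : ℝ) ≤ n := by exact_mod_cast hn
  have h3 := clog_le_log_div_add_one hN hn
  rw [Real.norm_of_nonneg (Real.log_nonneg hn1), id, Real.norm_of_nonneg (by positivity)] at h1
  have h4 : Real.log n / Real.log N ≤ n / (2 * c + 1) := by
    rw [div_le_iff₀ hlogN]
    calc Real.log n ≤ Real.log N / (2 * c + 1) * n := h1
      _ = _ := by ring
  have h2' : 2 * (c : ℝ) ≤ n := by exact_mod_cast h2
  have h5 : (c : ℝ) * (n / (2 * c + 1)) ≤ n / 2 := by
    rw [mul_div_assoc', div_le_div_iff₀ (by positivity) (by norm_num)]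
    nlinarith
  have h6 : (c : ℝ) * Nat.clog N n ≤ c * (n / (2 * c + 1) + 1) := by
    gcongr
    linarith
  have : (c : ℝ) * Nat.clog N n ≤ n := by linarith
  exact_mod_cast this

theorem eventually_rsat_triangle_le {t : ℕ} (ht : 3 ≤ t) {δ : ℝ} (hδ : 0 < δ) :
    ∀ᶠ n : ℕ in atTop, (rsat t n (⊤ : SimpleGraph (Fin 3)) : ℝ) ≤
      (1 + δ) * (t / (((t : ℝ) - 1) * Real.log ((t : ℝ) - 1)) * (n * Real.log n)) := by
  have ht' : (3 : ℝ) ≤ t := by exact_mod_cast ht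
  have hlog1 : 0 < Real.log ((t : ℝ) - 1) := Real.log_pos (by linarith)
  set ρ := ((t : ℝ) - 1) / t * Real.log ((t : ℝ) - 1) with hρ
  have hρ0 : 0 < ρ := mul_pos (div_pos (by linarith) (by linarith)) hlog1
  have hA : t / (((t : ℝ) - 1) * Real.log ((t : ℝ) - 1)) = 1 / ρ := by
    rw [hρ, div_mul_eq_mul_div, one_div_div]
  rw [hA]
  -- This loss makes the rate at least `ρ / (1 + δ / 2)`; the other `δ / 2` covers the rounding in
  -- `Nat.clog`.
  have hε : 0 < ρ - ρ / (1 + δ / 2) := by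
    rw [sub_pos]
    exact div_lt_self hρ0 (by linarith)
  obtain ⟨L, N, w, hL, hw, hN⟩ := exists_code (t := t) (by omega) hε
  rw [← hρ, sub_sub_cancel] at hN
  have hL0 : (0 : ℝ) < L := by exact_mod_cast hL
  have hlogN : 0 < Real.log N := lt_of_lt_of_le (by positivity) hN
  have hN2 : 2 ≤ N := by
    by_contra hcon
    have : N = 0 ∨ N = 1 := by omega
    rcases this with rfl | rfl <;> simp at hlogN
  have hlog : Tendsto (fun n : ℕ => Real.log n) atTop atTop :=
    Real.tendsto_log_atTop.comp tendsto_natCast_atTop_atTop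
  filter_upwards [eventually_mul_clog_le hN2 L, eventually_gt_atTop 0,
    hlog.eventually_ge_atTop (L * (2 * ρ / δ))] with n hn hn0 hlarge
  have hr : (rsat t n (⊤ : SimpleGraph (Fin 3)) : ℝ) ≤ L * Nat.clog N n * n := by
    exact_mod_cast rsat_triangle_le_of_code (by omega) hN2 w hw hn
  have hc := clog_le_log_div_add_one hN2 hn0
  have hn1 : (1 : ℝ) ≤ n := by exact_mod_cast hn0
  have hln : 0 ≤ Real.log n := Real.log_nonneg hn1
  have h1 : (L : ℝ) * (Real.log n / Real.log N) ≤ (1 + δ / 2) / ρ * Real.log n := by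
    rw [mul_div_assoc', div_le_iff₀ hlogN]
    have h2 : (L : ℝ) ≤ (1 + δ / 2) / ρ * Real.log N := by
      calc (L : ℝ) = (1 + δ / 2) / ρ * (L * (ρ / (1 + δ / 2))) := by field_simp
        _ ≤ _ := by gcongr
    nlinarith
  have h3 : (L : ℝ) ≤ δ / 2 / ρ * Real.log n := by
    calc (L : ℝ) = δ / 2 / ρ * (L * (2 * ρ / δ)) := by field_simp
      _ ≤ _ := by gcongr
  calc (rsat t n (⊤ : SimpleGraph (Fin 3)) : ℝ) ≤ L * Nat.clog N n * n := hr
    _ ≤ L * (Real.log n / Real.log N + 1) * n := by gcongr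
    _ = (L * (Real.log n / Real.log N) + L) * n := by ring
    _ ≤ ((1 + δ / 2) / ρ * Real.log n + δ / 2 / ρ * Real.log n) * n := by gcongr
    _ = _ := by field_simp; ring

theorem isBigO_rsat {s t : ℕ} (hs : 3 ≤ s) (ht : s.choose 2 ≤ t) :
    (fun n : ℕ => (rsat t n (⊤ : SimpleGraph (Fin s)) : ℝ)) =O[atTop]
      (fun n : ℕ => (n : ℝ) * Real.log n) := by
  obtain ⟨k, rfl⟩ : ∃ k, s = k + 2 := ⟨s - 2, by omega⟩
  have hlog : Tendsto (fun n : ℕ => Real.log n) atTop atTop :=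
    Real.tendsto_log_atTop.comp tendsto_natCast_atTop_atTop
  refine IsBigO.of_bound (t * k * (1 / Real.log 2 + 1)) ?_
  filter_upwards [eventually_mul_clog_le le_rfl (t * k), eventually_gt_atTop 0,
    hlog.eventually_ge_atTop 1] with n hn hn0 hlarge
  rw [mul_right_comm] at hn
  have hr : (rsat t n (⊤ : SimpleGraph (Fin (k + 2))) : ℝ) ≤ t * Nat.clog 2 n * k * n := by
    exact_mod_cast rsat_top_le_clog ht hn
  have hc := clog_le_log_div_add_one le_rfl hn0
  rw [Real.norm_of_nonneg (by positivity), Real.norm_of_nonneg (by positivity)]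
  calc (rsat t n (⊤ : SimpleGraph (Fin (k + 2))) : ℝ) ≤ t * Nat.clog 2 n * k * n := hr
    _ ≤ t * (Real.log n / Real.log (2 : ℕ) + 1) * k * n := by gcongr
    _ ≤ t * (Real.log n / Real.log (2 : ℕ) + Real.log n) * k * n := by gcongr
    _ = _ := by push_cast; ring

end Final

theorem mainTheorem1 (s t : ℕ) (hs : 3 ≤ s) (ht : s.choose 2 ≤ t) :
    (∃ ε : ℕ → ℝ, Tendsto ε atTop (𝓝 0) ∧
      ∀ᶠ n : ℕ in atTop,
        (t * (1 + ε n)) / (((t : ℝ) - s + 2) * Real.log ((t : ℝ) - s + 2)) * (n * Real.log n)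
          ≤ (rsat t n (⊤ : SimpleGraph (Fin s)) : ℝ)) ∧
    (s = 3 → ∃ ε : ℕ → ℝ, Tendsto ε atTop (𝓝 0) ∧
      ∀ᶠ n : ℕ in atTop,
        (rsat t n (⊤ : SimpleGraph (Fin s)) : ℝ) =
          (t * (1 + ε n)) / (((t : ℝ) - s + 2) * Real.log ((t : ℝ) - s + 2))
            * (n * Real.log n)) ∧
    (fun n : ℕ => (rsat t n (⊤ : SimpleGraph (Fin s)) : ℝ)) =Θ[atTop]
      (fun n : ℕ => (n : ℝ) * Real.log n) := by
  obtain ⟨hst, hQ⟩ := coeff_pos hs ht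
  have hlower := fun δ => eventually_le_rsat (δ := δ) hs ht
  have htri : s = 3 → ∀ δ : ℝ, 0 < δ → ∀ᶠ n : ℕ in atTop,
      (rsat t n (⊤ : SimpleGraph (Fin s)) : ℝ) ≤ (1 + δ) *
        (t / (((t : ℝ) - s + 2) * Real.log ((t : ℝ) - s + 2)) * (n * Real.log n)) := by
    rintro rfl δ hδ
    have h := eventually_rsat_triangle_le (t := t) hst hδ
    have e : (t : ℝ) - (3 : ℕ) + 2 = t - 1 := by push_cast; ring
    rw [e]
    exact h
  have hbigO := isBigO_rsat hs ht
  set Q := ((t : ℝ) - s + 2) * Real.log ((t : ℝ) - s + 2)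
  set r : ℕ → ℝ := fun n => (rsat t n (⊤ : SimpleGraph (Fin s)) : ℝ)
  have ht0 : (0 : ℝ) < t := by exact_mod_cast (show 0 < t by omega)
  have hA : 0 < t / Q := div_pos ht0 hQ
  let g : ℕ → ℝ := fun n => t / Q * (n * Real.log n)
  have hg : ∀ᶠ n : ℕ in atTop, 0 < g n := by
    filter_upwards [eventually_gt_atTop 1] with n hn
    have h1 : (1 : ℝ) < n := by exact_mod_cast hn
    have := Real.log_pos h1
    positivity
  have hform : ∀ x : ℝ, ∀ n : ℕ, (t * (1 + x)) / Q * (n * Real.log n) = (1 + x) * g n := by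
    intro x n
    simp only [g]
    ring
  have hge : ∀ δ : ℝ, 0 < δ → ∀ᶠ n in atTop, -δ < r n / g n - 1 := by
    intro δ hδ
    have hδ' : 0 < min (δ / 2) (1 / 2) := by positivity
    filter_upwards [hlower _ hδ' (by linarith [min_le_right (δ / 2) (1 / 2 : ℝ)]), hg] with n h1 h2
    have h3 := (le_div_iff₀ h2).2 h1
    linarith [min_le_left (δ / 2) (1 / 2 : ℝ)]
  -- For general `s` only the lower estimate on the ratio `r n / g n` is sharp, so the error is
  -- truncated at `0` to make it tend to `0`.
  refine ⟨⟨fun n => min 0 (r n / g n - 1), ?_, ?_⟩, fun hs3 => ⟨fun n => r n / g n - 1, ?_, ?_⟩,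
    hbigO, ?_⟩
  · rw [Metric.tendsto_nhds]
    intro δ hδ
    filter_upwards [hge δ hδ] with n hn
    rw [Real.dist_eq, sub_zero, abs_lt]
    exact ⟨lt_min (by linarith) hn, (min_le_left _ _).trans_lt hδ⟩
  · filter_upwards [hg] with n hn
    rw [hform, ← le_div_iff₀ hn]
    linarith [min_le_right 0 (r n / g n - 1)]
  · rw [Metric.tendsto_nhds]
    intro δ hδ
    filter_upwards [hge δ hδ, htri hs3 (δ / 2) (by linarith), hg] with n hn h2 h3
    rw [Real.dist_eq, sub_zero, abs_lt]
    have h4 := (div_le_iff₀ h3).2 h2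
    exact ⟨hn, by linarith⟩
  · filter_upwards [hg] with n hn
    rw [hform, add_sub_cancel, div_mul_cancel₀ _ hn.ne']
  · refine IsBigO.of_bound (2 * (t / Q)⁻¹) ?_
    filter_upwards [hge (1 / 2) (by norm_num), hg] with n h1 h2
    have h3 : 1 / 2 * g n ≤ r n := by
      rw [← le_div_iff₀ h2]; linarith
    have h4 : 0 ≤ r n := by positivity
    have h5 : 0 < n * Real.log n := (mul_pos_iff_of_pos_left hA).1 h2
    rw [Real.norm_of_nonneg h5.le, Real.norm_of_nonneg h4, mul_assoc, inv_mul_eq_div,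
      mul_div_assoc', le_div_iff₀ hA]
    change 1 / 2 * (t / Q * (n * Real.log n)) ≤ r n at h3
    linarith
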